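/- **Problem.** An instance of the super-martingale stopping problem consists of a horizon $n$ and nonnegative random variables $X_0,\dots,X_n$ forming a super-martingale with respect to a filtration $(\mathcal F_i)$, e.g. the natural one, or, for variables of finite support represented by a tree, the one whose atoms at time $i$ are the nodes of depth $i$: $\mathbf E(X_{i+1}\mid\mathcal F_i)\le X_i$. In round $i$ an online algorithm, which has observed only $X_0,\dots,X_i$ (and knows nothing else about the instance except possibly $n$), either stops and pays $i+X_i$ or goes on to round $i+1$; it must stop in round $n$ at the latest. A randomized algorithm may in addition use a random seed independent of the instance. If $i^*$ is the index at which it stops, its cost on the instance $I$ is $\mathrm{ALG}(I)=\mathbf E(i^*+X_{i^*})$. The benchmark $\mathrm{OPT}(I)$ is the infimum of $\mathbf E(\tau+X_\tau)$ over all $(\mathcal F_i)$-stopping times $\tau\le n$, i.e. over all stopping rules that know the instance (the tree) in advance. An algorithm is $\alpha$-competitive if $\mathrm{ALG}(I)\le\alpha\,\mathrm{OPT}(I)$ for every instance $I$. **Algorithm RandomizedStopping.** For a path $p=(v_0,v_1,\dots)$ of observed values let $v_p(t)=v_i$ for $t\in[i,i+1)$ and $Q_p(t)=\int_0^t\frac{1}{v_p(s)}\,ds\in[0,\infty]$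 (with $1/0=\infty$). Draw a threshold $\rho\in[0,1]$ with density $e^{\rho}/(e-1)$, and stop in the first round $i$ for which $Q_p$ reaches $\rho$ in $[i,i+1]$, that is, $Q_p(t)\ge\rho$ for some $t\in[i,i+1]$ (and in round $n$ if this has not happened before). **Theorem.** 1. RandomizedStopping is a polynomial-time algorithm: it is implemented by a randomized machine computing with real numbers (unit-cost $+,-,\times,\div,\exp,\log$, comparison, rational constants, and draws of independent uniform numbers from $[0,1]$) that is not told $n$ and whose total number of steps is bounded by a polynomial in the number of values it observes. 2. RandomizedStopping is $\frac{e}{e-1}$-competitive. 3. The ratio is tight: for every $\epsilon>0$, no randomized algorithm, whatever its running time, is $\left(\frac{e}{e-1}-\epsilon\right)$-competitive, even when restricted to the ski-rental instances, in which for some $B>0$ and some integer $T\ge1$ one has $X_i=B$ for $i<T$ and $X_i=0$ for $i\ge T$ deterministically. -/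

import Mathlib

open MeasureTheory ProbabilityTheory Set

universe u v

noncomputable section

/-! ### The super-martingale stopping problem -/

/-- An instance of the super-martingale stopping problem with rounds `0, …, n`, where `n` is the
horizon.  The nonnegative values `X 0, …, X n` form a supermartingale with respect to the
filtration `ℱ`; `ℱ i` is what an omniscient decision maker who knows the instance can distinguish
after round `i` (the depth-`i` nodes of a tree, or the natural filtration of `X`).
Terms of index larger than `n` play no role: a process given only up to `n` is extended by
`X i = X n`, `ℱ i = ℱ n`. -/
structure StoppingInstance : Type (v + 1) where
  Ω : Type v
  [mΩ : MeasurableSpace Ω]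
  P : Measure Ω
  [isProb : IsProbabilityMeasure P]
  horizon : ℕ
  ℱ : Filtration ℕ mΩ
  X : ℕ → Ω → ℝ
  nonneg : ∀ i ω, 0 ≤ X i ω
  supermartingale : Supermartingale X ℱ P

attribute [instance] StoppingInstance.mΩ StoppingInstance.isProb

namespace StoppingInstance

variable (I : StoppingInstance.{v})

/-- The stopping rules available to a decision maker who knows the instance in advance:
stopping times bounded by the horizon. -/
def StoppingRule : Type v :=
  {τ : I.Ω → ℕ // IsStoppingTime I.ℱ (fun ω => (τ ω : WithTop ℕ)) ∧ ∀ ω, τ ω ≤ I.horizon}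

/-- The expected cost `E (τ + X_τ)` of a stopping rule. -/
def ruleCost (τ : I.StoppingRule) : ℝ :=
  ∫ ω, ((τ.1 ω : ℝ) + I.X (τ.1 ω) ω) ∂I.P

/-- The optimal expected cost among all stopping rules that know the instance. -/
def opt : ℝ := ⨅ τ : I.StoppingRule, I.ruleCost τ

/-- Stopping immediately is a stopping rule. -/
theorem nonempty_stoppingRule : Nonempty I.StoppingRule :=
  ⟨⟨fun _ => 0, isStoppingTime_const I.ℱ 0, fun _ => Nat.zero_le _⟩⟩

/-- Every stopping rule has nonnegative cost. -/
theorem ruleCost_nonneg (τ : I.StoppingRule) : 0 ≤ I.ruleCost τ :=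
  integral_nonneg fun ω => add_nonneg (Nat.cast_nonneg _) (I.nonneg _ ω)

/-- The ski-rental instance with buying price `B` and season length `T`: deterministically
`X i = B` for `i < T` and `X i = 0` for `i ≥ T`. -/
def skiRental (B : ℝ) (hB : 0 < B) (T n : ℕ) : StoppingInstance.{v} where
  Ω := PUnit.{v + 1}
  P := Measure.dirac PUnit.unit
  horizon := n
  ℱ := Filtration.const ℕ ⊥ bot_le
  X := fun i _ => if i < T then B else 0
  nonneg := fun i _ => by
    split_ifs
    · exact hB.le
    · exact le_rfl
  supermartingale := by
    refine supermartingale_nat (fun i => stronglyMeasurable_const)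
      (fun i => integrable_const _) (fun i => ?_)
    rw [condExp_const (Filtration.le _ i)]
    refine Filter.Eventually.of_forall fun ω => ?_
    dsimp only
    split_ifs with h1 h2
    · exact le_rfl
    · omega
    · exact hB.le
    · exact le_rfl

/-- All ski-rental instances (with positive price and positive season length). -/
def skiRentalInstances : Set StoppingInstance.{v} :=
  {I | ∃ (B : ℝ) (hB : 0 < B) (T n : ℕ), 0 < T ∧ I = skiRental B hB T n}

end StoppingInstance

/-! ### Online randomized algorithms -/

/-- A randomized online stopping algorithm: a random seed is drawn once, and `stops n i s x` says
that, in round `i` of an instance with horizon `n`, the algorithm with seed `s` that has not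
stopped before stops, when the realizations are `x 0, x 1, …`.
This decision uses the observed values `x 0, …, x i` only. -/
structure RandomizedAlgorithm : Type (u + 1) where
  Seed : Type u
  [mSeed : MeasurableSpace Seed]
  law : Measure Seed
  [isProb : IsProbabilityMeasure law]
  stops : ℕ → ℕ → Seed → (ℕ → ℝ) → Prop
  online : ∀ n i s (x y : ℕ → ℝ), (∀ j ≤ i, x j = y j) → (stops n i s x ↔ stops n i s y)
  measurableSet_stops : ∀ n i, MeasurableSet {z : Seed × (ℕ → ℝ) | stops n i z.1 z.2}

attribute [instance] RandomizedAlgorithm.mSeed RandomizedAlgorithm.isProb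

namespace RandomizedAlgorithm

variable (A : RandomizedAlgorithm.{u})

/-- The index at which the algorithm stops; in the last round `n` it has to stop. -/
def stopIndex (n : ℕ) (s : A.Seed) (x : ℕ → ℝ) : ℕ :=
  sInf {i : ℕ | i = n ∨ A.stops n i s x}

/-- The expected cost `E (i* + X_{i*})` over the seed and the (independent) instance. -/
def cost (I : StoppingInstance.{v}) : ℝ :=
  ∫ z : A.Seed × I.Ω,
    ((A.stopIndex I.horizon z.1 (fun i => I.X i z.2) : ℝ)
      + I.X (A.stopIndex I.horizon z.1 (fun i => I.X i z.2)) z.2) ∂(A.law.prod I.P)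

/-- `A` is `α`-competitive on a class of instances. -/
def IsCompetitiveOn (C : Set StoppingInstance.{v}) (α : ℝ) : Prop :=
  ∀ I ∈ C, A.cost I ≤ α * I.opt

end RandomizedAlgorithm

/-! ### The algorithm -/

/-- The estimator `Q(t) = ∫_0^t 1 / v(s) ds` of a path `x`, where `v(s) = x i` for `s ∈ [i, i+1)`;
it takes values in `[0, ∞]`, with `1 / 0 = ∞`. -/
def estimator (x : ℕ → ℝ) (t : ℝ) : ENNReal :=
  ∫⁻ s in Ico 0 t, (ENNReal.ofReal (x ⌊s⌋₊))⁻¹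

/-- The law on `[0, 1]` with density `e ^ ρ / (e - 1)`. -/
def thresholdLaw : Measure ℝ :=
  (volume.restrict (Icc (0 : ℝ) 1)).withDensity
    (fun ρ => ENNReal.ofReal (Real.exp ρ / (Real.exp 1 - 1)))

theorem exp_one_sub_one_pos : 0 < Real.exp 1 - 1 := by
  have := Real.add_one_lt_exp (x := 1) one_ne_zero
  linarith

instance isProbabilityMeasure_thresholdLaw : IsProbabilityMeasure thresholdLaw := by
  constructor
  have h0 := exp_one_sub_one_pos
  rw [thresholdLaw, withDensity_apply _ MeasurableSet.univ, Measure.restrict_univ,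
    ← ofReal_integral_eq_lintegral_ofReal, integral_Icc_eq_integral_Ioc,
    ← intervalIntegral.integral_of_le zero_le_one, intervalIntegral.integral_div, integral_exp,
    Real.exp_zero, div_self h0.ne', ENNReal.ofReal_one]
  · exact (Continuous.continuousOn (by fun_prop)).integrableOn_compact isCompact_Icc
  · exact Filter.Eventually.of_forall fun ρ => by positivity

theorem estimator_mono (x : ℕ → ℝ) : Monotone (estimator x) :=
  fun _ _ h => lintegral_mono_set (Ico_subset_Ico_right h)

theorem measurable_estimator (t : ℝ) : Measurable fun x : ℕ → ℝ => estimator x t := by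
  unfold estimator
  refine Measurable.lintegral_prod_right' (f := fun z : (ℕ → ℝ) × ℝ =>
    (ENNReal.ofReal (z.1 ⌊z.2⌋₊))⁻¹) ?_
  have h1 : Measurable fun z : (ℕ → ℝ) × ℕ => z.1 z.2 :=
    measurable_from_prod_countable_left fun n => measurable_pi_apply n
  have h2 : Measurable fun z : (ℕ → ℝ) × ℝ => z.1 ⌊z.2⌋₊ :=
    h1.comp (measurable_fst.prodMk (Nat.measurable_floor.comp measurable_snd))
  exact (ENNReal.measurable_ofReal.comp h2).inv

theorem estimator_congr {i : ℕ} {x y : ℕ → ℝ} (h : ∀ j ≤ i, x j = y j) {t : ℝ}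
    (ht : t ≤ (i : ℝ) + 1) : estimator x t = estimator y t := by
  refine setLIntegral_congr_fun measurableSet_Ico fun s hs => ?_
  have : ⌊s⌋₊ ≤ i := by
    rw [← Nat.lt_succ_iff, Nat.floor_lt hs.1]
    push_cast
    exact hs.2.trans_le ht
  simp only [h _ this]

/-- Draw `ρ ∈ [0, 1]` with density `e ^ ρ / (e - 1)`, and stop in the first round `i` such that the
estimator reaches `ρ` within `[i, i + 1]`. (The inequality, in place of equality, matters only
when a zero value makes the estimator jump to `∞`: then the algorithm stops.) -/
def randomizedStopping : RandomizedAlgorithm.{0} where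
  Seed := ℝ
  law := thresholdLaw
  stops := fun _ i ρ x => ∃ t ∈ Icc (i : ℝ) (i + 1), ENNReal.ofReal ρ ≤ estimator x t
  online := fun _ i ρ x y h => by
    refine exists_congr fun t => and_congr_right fun ht => ?_
    rw [estimator_congr h ht.2]
  measurableSet_stops := fun _ i => by
    have : {z : ℝ × (ℕ → ℝ) | ∃ t ∈ Icc (i : ℝ) (i + 1), ENNReal.ofReal z.1 ≤ estimator z.2 t}
        = {z : ℝ × (ℕ → ℝ) | ENNReal.ofReal z.1 ≤ estimator z.2 (i + 1)} := by
      ext z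
      constructor
      · rintro ⟨t, ht, h⟩
        exact h.trans (estimator_mono _ ht.2)
      · exact fun h => ⟨i + 1, ⟨by linarith, le_rfl⟩, h⟩
    rw [this]
    exact measurableSet_le (ENNReal.measurable_ofReal.comp measurable_fst)
      ((measurable_estimator _).comp measurable_snd)

/-! ### Running time: real random access machines with unit costs -/

/-- Instructions of an online real-number machine.  Registers, numbered by `ℕ`, hold reals; every
instruction costs one step. -/
inductive Instr : Type where
  /-- `const r q`: write the rational constant `q` to register `r`. -/
  | const (r : ℕ) (q : ℚ)
  /-- `add r a b`, …: write the result for the contents of `a` and `b` to register `r`. -/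
  | add (r a b : ℕ)
  | sub (r a b : ℕ)
  | mul (r a b : ℕ)
  | div (r a b : ℕ)
  | exp (r a : ℕ)
  | log (r a : ℕ)
  /-- `rand r`: write a fresh uniform random number from `[0, 1]` to register `r`. -/
  | rand (r : ℕ)
  /-- `jlt a b l`: jump to line `l` if the content of `a` is smaller than that of `b`. -/
  | jlt (a b l : ℕ)
  /-- Do not stop in the current round; observe the next value, which is put in register `0`. -/
  | next
  /-- Stop in the current round. -/
  | halt

abbrev Program : Type := List Instr

/-- A configuration: the line to be executed, the registers, the number of random numbers used so
far, the current round, and whether the machine has stopped. -/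
structure Config : Type where
  line : ℕ
  reg : ℕ → ℝ
  used : ℕ
  round : ℕ
  halted : Bool

namespace Program

/-- Initially the machine is in round `0` and register `0` holds the first value. -/
def init (x : ℕ → ℝ) : Config where
  line := 0
  reg := Function.update (fun _ => 0) 0 (x 0)
  used := 0
  round := 0
  halted := false

/-- Write `a` to register `r` and proceed to the next line. -/
def write (c : Config) (r : ℕ) (a : ℝ) : Config :=
  { c with line := c.line + 1, reg := Function.update c.reg r a }

open scoped Classical in
/-- The effect of an instruction, with random tape `w`, input `x` and horizon `n`. Declining to
stop in the last round `n` leads to a forced stop in that round. -/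
def exec (w : ℕ → unitInterval) (x : ℕ → ℝ) (n : ℕ) (c : Config) : Instr → Config
  | .const r q => write c r (q : ℝ)
  | .add r a b => write c r (c.reg a + c.reg b)
  | .sub r a b => write c r (c.reg a - c.reg b)
  | .mul r a b => write c r (c.reg a * c.reg b)
  | .div r a b => write c r (c.reg a / c.reg b)
  | .exp r a => write c r (Real.exp (c.reg a))
  | .log r a => write c r (Real.log (c.reg a))
  | .rand r => { write c r (w c.used : ℝ) with used := c.used + 1 }
  | .jlt a b l => { c with line := if c.reg a < c.reg b then l else c.line + 1 }
  | .next =>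
      if c.round < n then { write c 0 (x (c.round + 1)) with round := c.round + 1 }
      else { c with halted := true }
  | .halt => { c with halted := true }

/-- One step. A machine that has stopped, or has left its program, does not change any more. -/
def step (prog : Program) (w : ℕ → unitInterval) (x : ℕ → ℝ) (n : ℕ) (c : Config) : Config :=
  if c.halted then c
  else match prog[c.line]? with
    | some ins => exec w x n c ins
    | none => c

/-- The configuration after `k` steps. -/
def after (prog : Program) (w : ℕ → unitInterval) (x : ℕ → ℝ) (n k : ℕ) : Config :=
  (step prog w x n)^[k] (init x)

end Program

/-- The law of the random tape: independent uniform numbers in `[0, 1]`. -/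
def tapeLaw : Measure (ℕ → unitInterval) :=
  Measure.infinitePi fun _ => (volume : Measure unitInterval)

/-- `A` is implemented by a polynomial-time randomized real-number machine, which is not told the
horizon: its random tape determines a seed with the right law, and on every nonnegative input
sequence it stops at the index at which `A` stops with that seed, after a total number of steps
that is polynomial in the number of values observed until then. -/
def RandomizedAlgorithm.IsPolyTime (A : RandomizedAlgorithm.{u}) : Prop :=
  ∃ (prog : Program) (φ : (ℕ → unitInterval) → A.Seed) (p : Polynomial ℕ),
    MeasurePreserving φ tapeLaw A.law ∧
    ∀ (w : ℕ → unitInterval) (x : ℕ → ℝ) (n : ℕ), (∀ i, 0 ≤ x i) →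
      ∃ k ≤ p.eval (A.stopIndex n (φ w) x + 1),
        (prog.after w x n k).halted = true ∧
        (prog.after w x n k).round = A.stopIndex n (φ w) x

end

/-! Upper bound. Along a path `x`, let `q_k` be the estimator at time `k` capped at 1, `F` the tail
of the threshold law and `α = e/(e-1)`. Round `i` is survived with probability `F(q_{i+1})`, so the
expected cost is `x_0 + ∑ F(q_{i+1}) (1 + x_{i+1} - x_i)`. Either `x_i (q_{i+1} - q_i) = 1` or
`q_{i+1} = 1` and `F` vanishes there, so the waiting cost 1 may be replaced by `x_i (q_{i+1} -
q_i)`. The density is chosen so that `F - F' = α`. With the concavity of `F`, summation by parts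
bounds the cost by `α M_n`, where `M_k = ∑_{i<k} x_i (q_{i+1} - q_i) + x_k (1 - q_k)`
(`integral_cost_path_le`). Now `M_k = x_0 + ∑_{i<k} (1 - q_{i+1}) (x_{i+1} - x_i)` is a transform of
the supermartingale by nonnegative predictable weights, hence a supermartingale. Optional stopping
gives `E M_n ≤ E M_τ` for every rule `τ`, and `M_k ≤ k + x_k` pointwise.

Lower bound. By averaging (Yao), take price `N` and a geometric season length with parameter `1/N`,
the mass beyond `N` being moved to length `2N`. Any algorithm then costs at least `N` on average,
while the average optimum is at most `N (1 - (1 - 1/N)^N)`; let `N → ∞`.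

Running time. A uniform number is turned into the threshold by inverting its distribution function,
and each round takes a bounded number of steps. -/

noncomputable section

/-! ### The stopping index and the cost of an algorithm -/

/-- The cost `k + x k` of stopping at `k` as a sum of increments. -/
theorem add_apply_eq_sum_increments (x : ℕ → ℝ) {k n : ℕ} (hk : k ≤ n) :
    (k : ℝ) + x k
      = x 0 + ∑ i ∈ Finset.range n, if i < k then 1 + (x (i + 1) - x i) else 0 := by
  rw [← Finset.sum_filter]
  have : (Finset.range n).filter (· < k) = Finset.range k := by
    ext i
    simp only [Finset.mem_filter, Finset.mem_range]
    omega
  rw [this, Finset.sum_add_distrib, Finset.sum_range_sub]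
  simp only [Finset.sum_const, Finset.card_range, nsmul_eq_mul, mul_one]
  ring

namespace RandomizedAlgorithm

variable (A : RandomizedAlgorithm.{u})

theorem stopIndex_le (n : ℕ) (s : A.Seed) (x : ℕ → ℝ) : A.stopIndex n s x ≤ n :=
  Nat.sInf_le (Or.inl rfl)

theorem lt_stopIndex_iff {n i : ℕ} (hi : i < n) (s : A.Seed) (x : ℕ → ℝ) :
    i < A.stopIndex n s x ↔ ∀ j ≤ i, ¬ A.stops n j s x := by
  constructor
  · intro h j hj hs
    exact (h.trans_le (Nat.sInf_le (Or.inr hs))).not_ge hj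
  · intro h
    by_contra! hle
    have hmem : A.stopIndex n s x = n ∨ A.stops n (A.stopIndex n s x) s x :=
      Nat.sInf_mem (s := {i | i = n ∨ A.stops n i s x}) ⟨n, Or.inl rfl⟩
    rcases hmem with h1 | h1
    · omega
    · exact h _ hle h1

theorem stopIndex_eq_of_stops {n i : ℕ} (hi : i ≤ n) {s : A.Seed} {x : ℕ → ℝ}
    (h : ∀ j < i, ¬ A.stops n j s x) (hs : i = n ∨ A.stops n i s x) :
    A.stopIndex n s x = i := by
  refine le_antisymm (Nat.sInf_le hs) ?_
  rcases Nat.eq_zero_or_pos i with rfl | hpos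
  · exact Nat.zero_le _
  · have := (A.lt_stopIndex_iff (show i - 1 < n by omega) s x).2 fun j hj => h j (by omega)
    omega

/-- Before the first difference of two inputs, the stopping indices agree. -/
theorem lt_stopIndex_congr {n i : ℕ} (hi : i < n) (s : A.Seed) {x y : ℕ → ℝ}
    (h : ∀ j ≤ i, x j = y j) : i < A.stopIndex n s x ↔ i < A.stopIndex n s y := by
  rw [A.lt_stopIndex_iff hi, A.lt_stopIndex_iff hi]
  refine forall₂_congr fun j hj => not_congr (A.online n j s x y fun l hl => h l (hl.trans hj))

theorem measurableSet_lt_stopIndex {n i : ℕ} (hi : i < n) :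
    MeasurableSet {z : A.Seed × (ℕ → ℝ) | i < A.stopIndex n z.1 z.2} := by
  have : {z : A.Seed × (ℕ → ℝ) | i < A.stopIndex n z.1 z.2}
      = ⋂ j, ⋂ (_ : j ≤ i), {z : A.Seed × (ℕ → ℝ) | A.stops n j z.1 z.2}ᶜ := by
    ext z
    simp [A.lt_stopIndex_iff hi]
  rw [this]
  exact MeasurableSet.iInter fun j => MeasurableSet.iInter fun _ =>
    (A.measurableSet_stops n j).compl

/-- Written as increments, the cost is a finite sum of integrable functions restricted to the
measurable events `i < stopIndex`. -/
theorem integrable_cost (I : StoppingInstance.{v}) :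
    Integrable (fun z : A.Seed × I.Ω =>
      ((A.stopIndex I.horizon z.1 (fun i => I.X i z.2) : ℝ)
        + I.X (A.stopIndex I.horizon z.1 (fun i => I.X i z.2)) z.2)) (A.law.prod I.P) := by
  have hX (i : ℕ) : Integrable (fun z : A.Seed × I.Ω => I.X i z.2) (A.law.prod I.P) :=
    (I.supermartingale.integrable i).comp_snd A.law
  have hmeas : Measurable fun z : A.Seed × I.Ω => (z.1, fun i => I.X i z.2) :=
    measurable_fst.prodMk (measurable_pi_lambda _ fun i =>
      (((I.supermartingale.stronglyMeasurable i).mono (I.ℱ.le i)).measurable.comp measurable_snd))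
  have key : ∀ z : A.Seed × I.Ω, _ := fun z =>
    add_apply_eq_sum_increments (fun i => I.X i z.2)
      (A.stopIndex_le I.horizon z.1 (fun i => I.X i z.2))
  simp only [key]
  refine (hX 0).add (integrable_finsetSum _ fun i hi => ?_)
  refine (Integrable.indicator (((integrable_const (1 : ℝ)).add ((hX (i + 1)).sub (hX i))))
    (hmeas (A.measurableSet_lt_stopIndex (Finset.mem_range.1 hi)))).congr
    (Filter.Eventually.of_forall fun z => ?_)
  simp [indicator_apply]

theorem cost_eq_integral_seed (I : StoppingInstance.{v}) :
    A.cost I = ∫ s, ∫ ω, ((A.stopIndex I.horizon s (fun i => I.X i ω) : ℝ)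
      + I.X (A.stopIndex I.horizon s (fun i => I.X i ω)) ω) ∂I.P ∂A.law :=
  integral_prod _ (A.integrable_cost I)

theorem cost_eq_integral_instance (I : StoppingInstance.{v}) :
    A.cost I = ∫ ω, ∫ s, ((A.stopIndex I.horizon s (fun i => I.X i ω) : ℝ)
      + I.X (A.stopIndex I.horizon s (fun i => I.X i ω)) ω) ∂A.law ∂I.P :=
  integral_prod_symm _ (A.integrable_cost I)

end RandomizedAlgorithm

namespace StoppingInstance

theorem opt_le_ruleCost (I : StoppingInstance.{v}) (τ : I.StoppingRule) : I.opt ≤ I.ruleCost τ :=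
  ciInf_le ⟨0, by rintro _ ⟨τ, rfl⟩; exact I.ruleCost_nonneg τ⟩ τ

theorem opt_nonneg (I : StoppingInstance.{v}) : 0 ≤ I.opt :=
  Real.iInf_nonneg I.ruleCost_nonneg

/-- Stopping in a fixed round bounds the optimum of a ski-rental instance. -/
theorem opt_skiRental_le {B : ℝ} (hB : 0 < B) {T n k : ℕ} (hk : k ≤ n) :
    (skiRental.{v} B hB T n).opt ≤ k + if k < T then B else 0 := by
  refine (opt_le_ruleCost (skiRental.{v} B hB T n)
    ⟨fun _ => k, isStoppingTime_const _ k, fun _ => hk⟩).trans_eq ?_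
  exact integral_dirac (f := fun _ => (k : ℝ) + if k < T then B else 0) PUnit.unit

end StoppingInstance

/-! ### The lower bound: a random season length -/

/-- The average over a geometric season length, truncated at `m`, of the cost of renting until
`k` and buying then at price `c`. -/
theorem sum_geometric_rent_or_buy {r c : ℝ} (hc : c * (1 - r) = 1) (k m : ℕ) :
    ∑ t ∈ Finset.range m, r ^ t * (1 - r) * (if k < t + 1 then k + c else ((t + 1 : ℕ) : ℝ))
      = c - r ^ m * (min (k : ℝ) m + c) := by
  -- `hc` balances one more day of rent against the chance `1 - r` of saving the price `c`; hence
  -- the main term does not depend on `k`.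
  induction m with
  | zero => simp
  | succ m ih =>
    rw [Finset.sum_range_succ, ih]
    by_cases h : k < m + 1
    · have h1 : min (k : ℝ) (m : ℝ) = k := min_eq_left (by exact_mod_cast Nat.lt_succ_iff.1 h)
      have h2 : min (k : ℝ) ((m + 1 : ℕ) : ℝ) = k := min_eq_left (by exact_mod_cast h.le)
      rw [if_pos h, h1, h2]
      ring
    · have h1 : min (k : ℝ) (m : ℝ) = m := min_eq_right (by exact_mod_cast (by omega : m ≤ k))
      have h2 : min (k : ℝ) ((m + 1 : ℕ) : ℝ) = (m + 1 : ℕ) :=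
        min_eq_right (by exact_mod_cast (by omega : m + 1 ≤ k))
      rw [if_neg h, h1, h2]
      push_cast
      linear_combination (-r ^ m) * hc

/-- The input of a ski-rental instance. -/
def skiRentalInput (B : ℝ) (T : ℕ) (i : ℕ) : ℝ := if i < T then B else 0

namespace RandomizedAlgorithm

variable (A : RandomizedAlgorithm.{u})

/-- The cost of `A` with seed `s` on the ski-rental instance with price `B` and length `T`. -/
def skiRentalCost (B : ℝ) (T n : ℕ) (s : A.Seed) : ℝ :=
  (A.stopIndex n s (skiRentalInput B T) : ℝ)
    + skiRentalInput B T (A.stopIndex n s (skiRentalInput B T))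

theorem cost_skiRental {B : ℝ} (hB : 0 < B) (T n : ℕ) :
    A.cost (StoppingInstance.skiRental.{v} B hB T n) = ∫ s, A.skiRentalCost B T n s ∂A.law := by
  rw [cost_eq_integral_seed]
  refine integral_congr_ae (Filter.Eventually.of_forall fun s => ?_)
  exact integral_dirac (f := fun _ => A.skiRentalCost B T n s) PUnit.unit

theorem integrable_skiRentalCost {B : ℝ} (hB : 0 < B) (T n : ℕ) :
    Integrable (A.skiRentalCost B T n) A.law := by
  refine ((A.integrable_cost (StoppingInstance.skiRental.{0} B hB T n)).integral_prod_left).congr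
    (Filter.Eventually.of_forall fun s => ?_)
  exact integral_dirac (f := fun _ => A.skiRentalCost B T n s) PUnit.unit

/-- The cost on a season of length `T` in terms of the behaviour in an endless season. -/
theorem rent_or_buy_le_skiRentalCost {B : ℝ} (hB : 0 < B) {T n : ℕ} (hT : T ≤ n) (s : A.Seed) :
    (if A.stopIndex n s (fun _ => B) < T then (A.stopIndex n s (fun _ => B) : ℝ) + B else T)
      ≤ A.skiRentalCost B T n s := by
  have hcongr {i : ℕ} (hi : i < T) := A.lt_stopIndex_congr (hi.trans_le hT) s
    (x := skiRentalInput B T) (y := fun _ => B)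
    fun j hj => if_pos (hj.trans_lt hi)
  unfold skiRentalCost
  set k := A.stopIndex n s (fun _ => B)
  set l := A.stopIndex n s (skiRentalInput B T)
  split_ifs with h
  · have h1 : l ≤ k := not_lt.1 fun hlt => lt_irrefl k ((hcongr h).1 hlt)
    have h2 : l = k := by
      by_contra hne
      exact lt_irrefl l ((hcongr (by omega)).2 (by omega))
    rw [h2, skiRentalInput, if_pos h]
  · have h1 : T ≤ l := by
      by_contra! hlt
      exact lt_irrefl l ((hcongr hlt).2 (by omega))
    have h2 : 0 ≤ skiRentalInput B T l := by
      unfold skiRentalInput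
      split_ifs <;> linarith
    have h3 : (T : ℝ) ≤ l := by exact_mod_cast h1
    linarith

/-- Yao's principle: competitiveness is averaged over season lengths `t + 1` with weight `r ^ t * (1
- r)` for `t < N`, and `2 * N` with the remaining weight `r ^ N`. -/
theorem one_le_of_isCompetitiveOn_skiRental {α : ℝ} (hα : 0 ≤ α)
    (h : A.IsCompetitiveOn StoppingInstance.skiRentalInstances.{v} α) {N : ℕ} (hN : 0 < N) :
    1 ≤ α * (1 - (1 + -1 / (N : ℝ)) ^ N) := by
  have hB : (0 : ℝ) < N := by exact_mod_cast hN
  set r : ℝ := 1 + -1 / (N : ℝ) with hr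
  have hc : (N : ℝ) * (1 - r) = 1 := by rw [hr]; field_simp; ring
  have h1N : (1 : ℝ) ≤ N := by exact_mod_cast hN
  have hr0 : 0 ≤ r := by
    rw [hr, neg_div, ← sub_eq_add_neg, sub_nonneg, div_le_one hB]
    exact h1N
  have hr1 : 0 ≤ 1 - r := by
    rw [hr]
    ring_nf
    positivity
  have hcost {T : ℕ} (hT : 0 < T) {k : ℕ} (hk : k ≤ 2 * N) :
      ∫ s, A.skiRentalCost N T (2 * N) s ∂A.law
        ≤ α * (k + if k < T then (N : ℝ) else 0) := by
    rw [← A.cost_skiRental.{u, v} hB]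
    exact (h _ ⟨N, hB, T, 2 * N, hT, rfl⟩).trans
      (mul_le_mul_of_nonneg_left (StoppingInstance.opt_skiRental_le hB hk) hα)
  -- The bound holds for each seed: the long season compensates the truncation term of the geometric
  -- sum.
  have hlow : (N : ℝ) ≤ ∫ s, (∑ t ∈ Finset.range N, r ^ t * (1 - r) *
      A.skiRentalCost N (t + 1) (2 * N) s) + r ^ N * A.skiRentalCost N (2 * N) (2 * N) s ∂A.law := by
    have hconst : (N : ℝ) = ∫ _, (N : ℝ) ∂A.law := by simp
    conv_lhs => rw [hconst]
    refine integral_mono (integrable_const _) ?_ fun s => ?_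
    · exact (integrable_finsetSum _ fun t _ => (A.integrable_skiRentalCost hB _ _).const_mul _).add
        ((A.integrable_skiRentalCost hB _ _).const_mul _)
    set k := A.stopIndex (2 * N) s (fun _ => (N : ℝ)) with hk
    have hk2 : k ≤ 2 * N := A.stopIndex_le _ _ _
    have hsum := Finset.sum_le_sum fun t (ht : t ∈ Finset.range N) =>
      mul_le_mul_of_nonneg_left (A.rent_or_buy_le_skiRentalCost hB (T := t + 1) (n := 2 * N)
        (by have := Finset.mem_range.1 ht; omega) s) (mul_nonneg (pow_nonneg hr0 t) hr1)
    rw [← hk, sum_geometric_rent_or_buy hc] at hsum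
    -- Length `2 * N` makes even renting throughout cost at least `min k N + N`.
    have hlast : min (k : ℝ) N + N ≤ A.skiRentalCost N (2 * N) (2 * N) s := by
      refine le_trans ?_ (A.rent_or_buy_le_skiRentalCost hB le_rfl s)
      rw [← hk]
      split_ifs with h2
      · linarith [min_le_left (k : ℝ) N]
      · push_cast
        linarith [min_le_right (k : ℝ) N]
    have := mul_le_mul_of_nonneg_left hlast (pow_nonneg hr0 N)
    dsimp only
    linarith
  rw [integral_add (integrable_finsetSum _ fun t _ =>
      (A.integrable_skiRentalCost hB _ _).const_mul _)
      ((A.integrable_skiRentalCost hB _ _).const_mul _),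
    integral_finsetSum _ fun t _ => (A.integrable_skiRentalCost hB _ _).const_mul _] at hlow
  simp only [integral_const_mul] at hlow
  have hup : ∑ t ∈ Finset.range N, r ^ t * (1 - r) *
      ∫ s, A.skiRentalCost N (t + 1) (2 * N) s ∂A.law
      ≤ ∑ t ∈ Finset.range N, α *
        (r ^ t * (1 - r) * if N < t + 1 then (N : ℝ) + N else ((t + 1 : ℕ) : ℝ)) := by
    refine Finset.sum_le_sum fun t ht => ?_
    have ht := Finset.mem_range.1 ht
    have := hcost (Nat.succ_pos t) (k := t + 1) (by omega)
    rw [if_neg (lt_irrefl _), add_zero] at this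
    rw [if_neg (by omega), mul_left_comm]
    exact mul_le_mul_of_nonneg_left this (mul_nonneg (pow_nonneg hr0 t) hr1)
  -- The average optimum over the short seasons is the same geometric sum with `k = N`: renting to
  -- the end.
  rw [← Finset.mul_sum, sum_geometric_rent_or_buy hc, min_self] at hup
  have hlast := hcost (show 0 < 2 * N by omega) (Nat.zero_le _)
  rw [if_pos (by omega), Nat.cast_zero, zero_add] at hlast
  have := mul_le_mul_of_nonneg_left hlast (pow_nonneg hr0 N)
  refine le_of_mul_le_mul_left ?_ hB
  linarith

theorem not_isCompetitiveOn_skiRental {α : ℝ} (hα : α < Real.exp 1 / (Real.exp 1 - 1)) :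
    ¬ A.IsCompetitiveOn StoppingInstance.skiRentalInstances.{v} α := by
  intro h
  have hpos := exp_one_sub_one_pos
  -- `α` may be negative, since `ε` is arbitrary in the theorem.
  have h' : A.IsCompetitiveOn StoppingInstance.skiRentalInstances.{v} (max α 0) :=
    fun I hI => (h I hI).trans (mul_le_mul_of_nonneg_right (le_max_left _ _) I.opt_nonneg)
  have hlim : Filter.Tendsto (fun N : ℕ => max α 0 * (1 - (1 + -1 / (N : ℝ)) ^ N)) Filter.atTop
      (nhds (max α 0 * (1 - Real.exp (-1)))) :=
    ((Real.tendsto_one_add_div_pow_exp (-1)).const_sub 1).const_mul _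
  have h1 : 1 ≤ max α 0 * (1 - Real.exp (-1)) := by
    refine ge_of_tendsto hlim ?_
    filter_upwards [Filter.eventually_gt_atTop 0] with N hN
    exact A.one_le_of_isCompetitiveOn_skiRental (le_max_right _ _) h' hN
  have h2 : 1 - Real.exp (-1) = (Real.exp 1 - 1) / Real.exp 1 := by
    rw [Real.exp_neg]
    field_simp
  have h3 : max α 0 < Real.exp 1 / (Real.exp 1 - 1) := max_lt hα (by positivity)
  rw [h2, ← mul_div_assoc, one_le_div (Real.exp_pos 1), ← div_le_iff₀ hpos] at h1
  exact h3.not_ge h1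

end RandomizedAlgorithm

end

noncomputable section

/-! ### The estimator at integer times -/

theorem estimator_natCast (x : ℕ → ℝ) (k : ℕ) :
    estimator x k = ∑ j ∈ Finset.range k, (ENNReal.ofReal (x j))⁻¹ := by
  induction k with
  | zero => simp [estimator]
  | succ k ih =>
    have hunion : Ico (0 : ℝ) ((k + 1 : ℕ) : ℝ) = Ico 0 (k : ℝ) ∪ Ico (k : ℝ) ((k + 1 : ℕ) : ℝ) :=
      (Ico_union_Ico_eq_Ico (Nat.cast_nonneg k) (by simp)).symm
    have hlast : ∫⁻ s in Ico (k : ℝ) ((k + 1 : ℕ) : ℝ), (ENNReal.ofReal (x ⌊s⌋₊))⁻¹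
        = (ENNReal.ofReal (x k))⁻¹ := by
      rw [setLIntegral_congr_fun (g := fun _ => (ENNReal.ofReal (x k))⁻¹) measurableSet_Ico
        fun s hs => ?_]
      · simp
      · have : ⌊s⌋₊ = k := Nat.floor_eq_on_Ico k s (by simpa using hs)
        simp only [this]
    rw [Finset.sum_range_succ, ← ih, ← hlast, estimator, estimator, hunion]
    exact lintegral_union measurableSet_Ico Ico_disjoint_Ico_same

theorem estimator_succ (x : ℕ → ℝ) (k : ℕ) :
    estimator x ((k : ℝ) + 1) = estimator x k + (ENNReal.ofReal (x k))⁻¹ := by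
  have := estimator_natCast x (k + 1)
  push_cast at this
  rw [this, estimator_natCast, Finset.sum_range_succ]

theorem randomizedStopping_stops_iff {n i : ℕ} {ρ : ℝ} {x : ℕ → ℝ} :
    randomizedStopping.stops n i ρ x ↔ ENNReal.ofReal ρ ≤ estimator x ((i : ℝ) + 1) := by
  constructor
  · rintro ⟨t, ht, h⟩
    exact h.trans (estimator_mono _ ht.2)
  · exact fun h => ⟨i + 1, ⟨by linarith, le_rfl⟩, h⟩

theorem lt_stopIndex_randomizedStopping_iff {n i : ℕ} (hi : i < n) {ρ : ℝ} {x : ℕ → ℝ} :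
    i < randomizedStopping.stopIndex n ρ x ↔
      estimator x ((i : ℝ) + 1) < ENNReal.ofReal ρ := by
  refine (randomizedStopping.lt_stopIndex_iff hi ρ x).trans ?_
  constructor
  · exact fun h => not_le.1 fun hle => h i le_rfl (randomizedStopping_stops_iff.2 hle)
  · intro h j hj hs
    refine (h.trans_le (randomizedStopping_stops_iff.1 hs)).not_ge (estimator_mono x ?_)
    have : (j : ℝ) ≤ i := by exact_mod_cast hj
    linarith

/-- A zero value sends the estimator to `∞`, past every threshold. -/
theorem pos_of_not_stops {n i : ℕ} {ρ : ℝ} {x : ℕ → ℝ} (hx : ∀ i, 0 ≤ x i)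
    (h : ¬ randomizedStopping.stops n i ρ x) : 0 < x i := by
  refine (hx i).lt_of_ne fun h0 => h (randomizedStopping_stops_iff.2 ?_)
  simp [estimator_succ, ← h0]

theorem stops_iff_of_pos {n i : ℕ} {ρ : ℝ} {x : ℕ → ℝ} (hx : ∀ j ≤ i, 0 < x j) :
    randomizedStopping.stops n i ρ x ↔ ρ ≤ ∑ j ∈ Finset.range (i + 1), (x j)⁻¹ := by
  have hpos (j : ℕ) (hj : j ∈ Finset.range (i + 1)) : 0 < x j :=
    hx j (Nat.lt_succ_iff.1 (Finset.mem_range.1 hj))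
  have h := estimator_natCast x (i + 1)
  rw [Finset.sum_congr rfl fun j hj => (ENNReal.ofReal_inv_of_pos (hpos j hj)).symm,
    ← ENNReal.ofReal_sum_of_nonneg fun j hj => (inv_pos.2 (hpos j hj)).le] at h
  push_cast at h
  rw [randomizedStopping_stops_iff, h, ENNReal.ofReal_le_ofReal_iff]
  exact Finset.sum_nonneg fun j hj => (inv_pos.2 (hpos j hj)).le

/-- The estimator at time `k`, capped at `1`. -/
def cappedEstimator (x : ℕ → ℝ) (k : ℕ) : ℝ := (min (estimator x k) 1).toReal

theorem min_estimator_ne_top (x : ℕ → ℝ) (k : ℕ) : min (estimator x k) 1 ≠ ⊤ :=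
  ((min_le_right _ _).trans_lt ENNReal.one_lt_top).ne

theorem cappedEstimator_zero (x : ℕ → ℝ) : cappedEstimator x 0 = 0 := by
  simp [cappedEstimator, estimator]

theorem cappedEstimator_nonneg (x : ℕ → ℝ) (k : ℕ) : 0 ≤ cappedEstimator x k :=
  ENNReal.toReal_nonneg

theorem cappedEstimator_le_one (x : ℕ → ℝ) (k : ℕ) : cappedEstimator x k ≤ 1 :=
  ENNReal.toReal_le_of_le_ofReal zero_le_one (by simp)

theorem cappedEstimator_le_succ (x : ℕ → ℝ) (k : ℕ) :
    cappedEstimator x k ≤ cappedEstimator x (k + 1) :=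
  ENNReal.toReal_mono (min_estimator_ne_top x _)
    (min_le_min_right _ (estimator_mono x (by simp)))

/-- The strict bound `j < k` is what makes the estimator predictable. -/
theorem measurable_cappedEstimator {Ω : Type*} {m : MeasurableSpace Ω} {X : ℕ → Ω → ℝ} {k : ℕ}
    (hX : ∀ j < k, Measurable[m] (X j)) :
    Measurable[m] fun ω => cappedEstimator (fun i => X i ω) k := by
  unfold cappedEstimator
  simp only [estimator_natCast]
  refine ((Finset.measurable_fun_sum _ fun j hj => ?_).min measurable_const).ennreal_toReal
  exact (hX j (Finset.mem_range.1 hj)).ennreal_ofReal.inv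

theorem mul_cappedEstimator_step_le_one {x : ℕ → ℝ} (k : ℕ) :
    x k * (cappedEstimator x (k + 1) - cappedEstimator x k) ≤ 1 := by
  have hd := sub_nonneg.2 (cappedEstimator_le_succ x k)
  rcases le_or_gt (x k) 0 with h0 | h0
  · exact (mul_nonpos_of_nonpos_of_nonneg h0 hd).trans zero_le_one
  have hle : cappedEstimator x (k + 1) ≤ cappedEstimator x k + (x k)⁻¹ := by
    have h1 : min (estimator x ((k : ℝ) + 1)) 1
        ≤ min (estimator x k) 1 + ENNReal.ofReal (x k)⁻¹ := by
      rw [estimator_succ, ENNReal.ofReal_inv_of_pos h0]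
      rcases le_total (estimator x k) 1 with h | h
      · rw [min_eq_left h]
        exact min_le_left _ _
      · rw [min_eq_right h]
        exact (min_le_right _ _).trans le_self_add
    have h2 := ENNReal.toReal_mono
      (ENNReal.add_ne_top.2 ⟨min_estimator_ne_top x k, ENNReal.ofReal_ne_top⟩) h1
    rw [ENNReal.toReal_add (min_estimator_ne_top x k) ENNReal.ofReal_ne_top,
      ENNReal.toReal_ofReal (inv_pos.2 h0).le] at h2
    simpa [cappedEstimator] using h2
  calc x k * (cappedEstimator x (k + 1) - cappedEstimator x k) ≤ x k * (x k)⁻¹ :=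
        mul_le_mul_of_nonneg_left (by linarith) h0.le
    _ = 1 := mul_inv_cancel₀ h0.ne'

theorem cappedEstimator_succ_eq_one_or {x : ℕ → ℝ} (hx : ∀ i, 0 ≤ x i) (k : ℕ) :
    cappedEstimator x (k + 1) = 1 ∨
      x k * (cappedEstimator x (k + 1) - cappedEstimator x k) = 1 := by
  rcases le_or_gt 1 (estimator x ((k : ℝ) + 1)) with h | h
  · left
    simp [cappedEstimator, min_eq_right h]
  right
  have h0 : 0 < x k := by
    refine (hx k).lt_of_ne fun h0 => ?_
    simp [estimator_succ, ← h0] at h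
  have hk : estimator x k < 1 := (estimator_mono x (by simp)).trans_lt h
  have : cappedEstimator x (k + 1) = cappedEstimator x k + (x k)⁻¹ := by
    simp only [cappedEstimator, Nat.cast_add, Nat.cast_one]
    rw [min_eq_left h.le, min_eq_left hk.le, estimator_succ, ← ENNReal.ofReal_inv_of_pos h0,
      ENNReal.toReal_add (hk.trans ENNReal.one_lt_top).ne ENNReal.ofReal_ne_top,
      ENNReal.toReal_ofReal (inv_pos.2 h0).le]
  rw [this, add_sub_cancel_left, mul_inv_cancel₀ h0.ne']

/-! ### The law of the threshold -/

theorem thresholdLaw_Iic {a : ℝ} (h0 : 0 ≤ a) (h1 : a ≤ 1) :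
    thresholdLaw (Iic a) = ENNReal.ofReal ((Real.exp a - 1) / (Real.exp 1 - 1)) := by
  have hpos := exp_one_sub_one_pos
  have hinter : Iic a ∩ Icc (0 : ℝ) 1 = Icc 0 a := by
    ext t
    simp only [mem_inter_iff, mem_Iic, mem_Icc]
    constructor
    · exact fun h => ⟨h.2.1, h.1⟩
    · exact fun h => ⟨h.2, h.1, h.2.trans h1⟩
  rw [thresholdLaw, withDensity_apply _ measurableSet_Iic,
    Measure.restrict_restrict measurableSet_Iic, hinter,
    ← ofReal_integral_eq_lintegral_ofReal, integral_Icc_eq_integral_Ioc,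
    ← intervalIntegral.integral_of_le h0, intervalIntegral.integral_div, integral_exp,
    Real.exp_zero]
  · exact (Continuous.continuousOn (by fun_prop)).integrableOn_compact isCompact_Icc
  · exact Filter.Eventually.of_forall fun ρ => by positivity

theorem thresholdLaw_Iic_of_neg {a : ℝ} (ha : a < 0) : thresholdLaw (Iic a) = 0 := by
  refine measure_mono_null (t := (Icc (0 : ℝ) 1)ᶜ) (fun t ht h => ?_) ?_
  · exact (h.1.trans ht).not_gt ha
  · refine withDensity_absolutelyContinuous _ _ ?_
    rw [Measure.restrict_apply measurableSet_Icc.compl, compl_inter_self, measure_empty]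

/-- The probability that the threshold exceeds `a ∈ [0, 1]`. -/
def thresholdTail (a : ℝ) : ℝ := (Real.exp 1 - Real.exp a) / (Real.exp 1 - 1)

theorem thresholdLaw_real_Ioi {a : ℝ} (h0 : 0 ≤ a) (h1 : a ≤ 1) :
    thresholdLaw.real (Ioi a) = thresholdTail a := by
  have hpos := exp_one_sub_one_pos
  rw [← compl_Iic, probReal_compl_eq_one_sub measurableSet_Iic, measureReal_def,
    thresholdLaw_Iic h0 h1, ENNReal.toReal_ofReal
      (div_nonneg (by linarith [Real.one_le_exp h0]) hpos.le), thresholdTail]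
  field_simp
  ring

/-- Capping is harmless because the threshold is almost surely at most 1. -/
theorem thresholdLaw_real_estimator_lt (x : ℕ → ℝ) (k : ℕ) :
    thresholdLaw.real {ρ | estimator x k < ENNReal.ofReal ρ}
      = thresholdTail (cappedEstimator x k) := by
  rw [← thresholdLaw_real_Ioi (cappedEstimator_nonneg x k) (cappedEstimator_le_one x k)]
  have hae : ∀ᵐ ρ ∂thresholdLaw, ρ ∈ Icc (0 : ℝ) 1 :=
    (withDensity_absolutelyContinuous _ _).ae_le (ae_restrict_mem measurableSet_Icc)
  refine measureReal_congr ?_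
  filter_upwards [hae] with ρ hρ
  refine propext ?_
  change estimator x k < ENNReal.ofReal ρ ↔ cappedEstimator x k < ρ
  rw [cappedEstimator, ← ENNReal.lt_ofReal_iff_toReal_lt (min_estimator_ne_top x k), min_lt_iff]
  refine ⟨Or.inl, fun h => h.resolve_right fun h1 => h1.not_ge ?_⟩
  exact ENNReal.ofReal_le_one.2 hρ.2

theorem thresholdTail_one : thresholdTail 1 = 0 := by simp [thresholdTail]

theorem thresholdTail_zero : thresholdTail 0 = 1 := by
  simp [thresholdTail, exp_one_sub_one_pos.ne']

theorem exp_sub_exp_le (a b : ℝ) : Real.exp b - Real.exp a ≤ (b - a) * Real.exp b := by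
  have h1 := Real.add_one_le_exp (a - b)
  have h2 : Real.exp a = Real.exp (a - b) * Real.exp b := by rw [← Real.exp_add]; ring_nf
  rw [h2]
  nlinarith [Real.exp_pos b]

/-- The concave tail lies below its tangent at 1. -/
theorem thresholdTail_le (a : ℝ) :
    thresholdTail a ≤ Real.exp 1 / (Real.exp 1 - 1) * (1 - a) := by
  rw [thresholdTail, div_mul_eq_mul_div]
  refine div_le_div_of_nonneg_right ?_ exp_one_sub_one_pos.le
  linarith [exp_sub_exp_le a 1]

/-- Discrete form of `F - F' = e/(e-1)` for the tail `F`: by concavity, `F a - F b ≤ -(b - a) F' b`.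
-/
theorem thresholdTail_step_le (a b : ℝ) :
    (b - a) * thresholdTail b + (thresholdTail a - thresholdTail b)
      ≤ Real.exp 1 / (Real.exp 1 - 1) * (b - a) := by
  have h : (b - a) * thresholdTail b + (thresholdTail a - thresholdTail b)
      = ((b - a) * (Real.exp 1 - Real.exp b) + (Real.exp b - Real.exp a))
        / (Real.exp 1 - 1) := by
    unfold thresholdTail
    ring
  rw [h, div_mul_eq_mul_div]
  refine div_le_div_of_nonneg_right ?_ exp_one_sub_one_pos.le
  linarith [exp_sub_exp_le a b]

/-! ### The expected cost along a path -/

theorem integral_cost_path (x : ℕ → ℝ) (n : ℕ) :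
    ∫ ρ, ((randomizedStopping.stopIndex n ρ x : ℝ) + x (randomizedStopping.stopIndex n ρ x))
        ∂thresholdLaw
      = x 0 + ∑ i ∈ Finset.range n,
        thresholdTail (cappedEstimator x (i + 1)) * (1 + (x (i + 1) - x i)) := by
  have hset (i : ℕ) : MeasurableSet {ρ : ℝ | estimator x ((i + 1 : ℕ) : ℝ) < ENNReal.ofReal ρ} :=
    measurableSet_lt measurable_const ENNReal.measurable_ofReal
  have key (ρ : ℝ) : (randomizedStopping.stopIndex n ρ x : ℝ)
      + x (randomizedStopping.stopIndex n ρ x)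
      = x 0 + ∑ i ∈ Finset.range n,
        {ρ : ℝ | estimator x ((i + 1 : ℕ) : ℝ) < ENNReal.ofReal ρ}.indicator
          (fun _ => 1 + (x (i + 1) - x i)) ρ := by
    rw [add_apply_eq_sum_increments x (randomizedStopping.stopIndex_le n ρ x)]
    congr 1
    refine Finset.sum_congr rfl fun i hi => ?_
    have := lt_stopIndex_randomizedStopping_iff (Finset.mem_range.1 hi) (ρ := ρ) (x := x)
    simp only [this, indicator_apply, mem_ofPred_eq, Nat.cast_add, Nat.cast_one]
  simp only [key]
  have hint (i : ℕ) := (integrable_const (μ := thresholdLaw) (1 + (x (i + 1) - x i))).indicator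
    (hset i)
  rw [integral_add (integrable_const _) (integrable_finsetSum _ fun i _ => hint i),
    integral_finsetSum _ fun i _ => hint i]
  congr 1
  · simp
  · refine Finset.sum_congr rfl fun i _ => ?_
    rw [integral_indicator_const _ (hset i), thresholdLaw_real_estimator_lt, smul_eq_mul]

/-- Up to the factor `e / (e - 1)`, a bound for the cost of `randomizedStopping` along a path. -/
def pathPotential (x : ℕ → ℝ) (k : ℕ) : ℝ :=
  ∑ i ∈ Finset.range k, x i * (cappedEstimator x (i + 1) - cappedEstimator x i)
    + x k * (1 - cappedEstimator x k)

/-- Summation by parts, exhibiting the potential as a supermartingale transform. -/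
theorem pathPotential_eq (x : ℕ → ℝ) (k : ℕ) :
    pathPotential x k
      = x 0 + ∑ i ∈ Finset.range k, (1 - cappedEstimator x (i + 1)) * (x (i + 1) - x i) := by
  unfold pathPotential
  induction k with
  | zero => simp [cappedEstimator_zero]
  | succ k ih =>
    rw [Finset.sum_range_succ, Finset.sum_range_succ]
    linear_combination ih

theorem pathPotential_le {x : ℕ → ℝ} (hx : ∀ i, 0 ≤ x i) (k : ℕ) : pathPotential x k ≤ k + x k := by
  refine add_le_add ?_ ?_
  · refine (Finset.sum_le_sum fun i _ => mul_cappedEstimator_step_le_one i).trans ?_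
    simp
  · exact mul_le_of_le_one_right (hx k) (by linarith [cappedEstimator_nonneg x k])

theorem integral_cost_path_le {x : ℕ → ℝ} (hx : ∀ i, 0 ≤ x i) (n : ℕ) :
    ∫ ρ, ((randomizedStopping.stopIndex n ρ x : ℝ) + x (randomizedStopping.stopIndex n ρ x))
        ∂thresholdLaw
      ≤ Real.exp 1 / (Real.exp 1 - 1) * pathPotential x n := by
  rw [integral_cost_path]
  set α := Real.exp 1 / (Real.exp 1 - 1)
  have hlast := mul_le_mul_of_nonneg_left (thresholdTail_le (cappedEstimator x n)) (hx n)
  -- The induction keeps the exact tail in the last term; bounding it by the tangent earlier would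
  -- break the telescoping.
  suffices h : x 0 + ∑ i ∈ Finset.range n,
      thresholdTail (cappedEstimator x (i + 1)) * (1 + (x (i + 1) - x i))
      ≤ α * ∑ i ∈ Finset.range n, x i * (cappedEstimator x (i + 1) - cappedEstimator x i)
        + x n * thresholdTail (cappedEstimator x n) by
    unfold pathPotential
    linarith
  clear hlast
  induction n with
  | zero => simp [cappedEstimator_zero, thresholdTail_zero]
  | succ n ih =>
    rw [Finset.sum_range_succ, Finset.sum_range_succ]
    have hstep := mul_le_mul_of_nonneg_left
      (thresholdTail_step_le (cappedEstimator x n) (cappedEstimator x (n + 1))) (hx n)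
    have htail : thresholdTail (cappedEstimator x (n + 1))
        = x n * (cappedEstimator x (n + 1) - cappedEstimator x n)
          * thresholdTail (cappedEstimator x (n + 1)) := by
      rcases cappedEstimator_succ_eq_one_or hx n with h | h
      · rw [h, thresholdTail_one, mul_zero]
      · rw [h, one_mul]
    linarith

/-! ### The competitive ratio -/

namespace StoppingInstance

variable (I : StoppingInstance.{v})

theorem supermartingale_pathPotential :
    Supermartingale (fun k ω => pathPotential (fun i => I.X i ω) k) I.ℱ I.P := by
  -- The transform lemma concerns submartingales and sums starting at 0, hence the negation here and
  -- the constant martingale `X 0` added below.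
  have hsub := Submartingale.sum_mul_sub (R := 1)
    (ξ := fun k ω => 1 - cappedEstimator (fun i => I.X i ω) (k + 1)) I.supermartingale.neg
    (fun k => ?_) (fun k ω => by linarith [cappedEstimator_nonneg (fun i => I.X i ω) (k + 1)])
    (fun k ω => by linarith [cappedEstimator_le_one (fun i => I.X i ω) (k + 1)])
  · have hmart : Martingale (fun _ : ℕ => I.X 0) I.ℱ I.P := by
      refine ⟨fun i => (I.supermartingale.stronglyMeasurable 0).mono (I.ℱ.mono (Nat.zero_le i)),
        fun i j _ => ?_⟩
      rw [condExp_of_stronglyMeasurable (I.ℱ.le i)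
        ((I.supermartingale.stronglyMeasurable 0).mono (I.ℱ.mono (Nat.zero_le i)))
        (I.supermartingale.integrable 0)]
    convert! hsub.neg.add_martingale hmart using 1
    ext k ω
    rw [pathPotential_eq]
    simp only [Pi.add_apply, Pi.neg_apply, Finset.sum_apply, Pi.mul_apply, Pi.sub_apply]
    rw [add_comm, ← Finset.sum_neg_distrib]
    congr 1
    exact Finset.sum_congr rfl fun i _ => by ring
  · refine Measurable.stronglyMeasurable (measurable_const.sub ?_)
    exact measurable_cappedEstimator fun j hj =>
      ((I.supermartingale.stronglyMeasurable j).mono (I.ℱ.mono (by omega))).measurable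

theorem integrable_stopped (τ : I.StoppingRule) {Y : ℕ → I.Ω → ℝ}
    (hY : ∀ i, Integrable (Y i) I.P) : Integrable (fun ω => Y (τ.1 ω) ω) I.P :=
  integrable_stoppedValue ℕ τ.2.1 hY (N := I.horizon)
    fun ω => WithTop.coe_le_coe.2 (τ.2.2 ω)

theorem integral_pathPotential_horizon_le (τ : I.StoppingRule) :
    ∫ ω, pathPotential (fun i => I.X i ω) I.horizon ∂I.P
      ≤ ∫ ω, pathPotential (fun i => I.X i ω) (τ.1 ω) ∂I.P := by
  have h := I.supermartingale_pathPotential.neg.expected_stoppedValue_mono τ.2.1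
    (isStoppingTime_const I.ℱ I.horizon)
    (fun ω => WithTop.coe_le_coe.2 (τ.2.2 ω)) (N := I.horizon) (fun ω => le_rfl)
  simp only [stoppedValue, Pi.neg_apply, integral_neg, neg_le_neg_iff] at h
  exact h

theorem cost_randomizedStopping_le (τ : I.StoppingRule) :
    randomizedStopping.cost I ≤ Real.exp 1 / (Real.exp 1 - 1) * I.ruleCost τ := by
  have hα : 0 ≤ Real.exp 1 / (Real.exp 1 - 1) :=
    div_nonneg (Real.exp_pos 1).le exp_one_sub_one_pos.le
  have hM := I.supermartingale_pathPotential.integrable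
  calc randomizedStopping.cost I
      ≤ ∫ ω, Real.exp 1 / (Real.exp 1 - 1) * pathPotential (fun i => I.X i ω) I.horizon ∂I.P := by
        rw [RandomizedAlgorithm.cost_eq_integral_instance]
        exact integral_mono (randomizedStopping.integrable_cost I).integral_prod_right
          ((hM _).const_mul _) fun ω => integral_cost_path_le (fun i => I.nonneg i ω) _
    _ ≤ Real.exp 1 / (Real.exp 1 - 1) * I.ruleCost τ := by
        rw [integral_const_mul]
        refine mul_le_mul_of_nonneg_left ?_ hα
        refine (I.integral_pathPotential_horizon_le τ).trans ?_
        refine integral_mono (I.integrable_stopped τ hM)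
          (I.integrable_stopped τ (Y := fun k ω => (k : ℝ) + I.X k ω) fun i =>
            (integrable_const _).add (I.supermartingale.integrable i))
          fun ω => pathPotential_le (fun i => I.nonneg i ω) _

end StoppingInstance

theorem isCompetitiveOn_randomizedStopping :
    randomizedStopping.IsCompetitiveOn (Set.univ : Set StoppingInstance.{v})
      (Real.exp 1 / (Real.exp 1 - 1)) := by
  intro I _
  have := I.nonempty_stoppingRule
  have hα : 0 < Real.exp 1 / (Real.exp 1 - 1) :=
    div_pos (Real.exp_pos 1) exp_one_sub_one_pos
  rw [← div_le_iff₀' hα]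
  exact le_ciInf fun τ => (div_le_iff₀' hα).2 (I.cost_randomizedStopping_le τ)

end

noncomputable section

/-! ### A program for `randomizedStopping` -/

/-- Registers: `0` the current value `x`, `1` the threshold, `2` the estimator, `3` the number `1`,
`4` the number `e - 1`, `5` the number `0`, `6` the number `1 / x`. -/
def stoppingProgram : Program :=
  [.const 3 1, .exp 4 3, .sub 4 4 3, .rand 1, .mul 1 1 4, .add 1 1 3, .log 1 1,
    .jlt 5 0 9, .halt, .div 6 3 0, .add 2 2 6, .jlt 2 1 13, .halt, .next, .jlt 5 3 7]

/-- The threshold computed from a uniform random number: inversion of the distribution function. -/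
def thresholdOfUniform (a : unitInterval) : ℝ :=
  Real.log ((a : ℝ) * (Real.exp 1 - 1) + 1)

theorem measurable_thresholdOfUniform : Measurable thresholdOfUniform :=
  Real.measurable_log.comp ((measurable_subtype_coe.mul_const _).add_const _)

/-- Inverse transform sampling; the distribution functions are compared below 0, on `[0, 1]` and
above 1. -/
theorem measurePreserving_thresholdOfUniform :
    MeasurePreserving thresholdOfUniform volume thresholdLaw := by
  refine ⟨measurable_thresholdOfUniform, ?_⟩
  have h0 := exp_one_sub_one_pos
  have hprob := Measure.isProbabilityMeasure_map (μ := (volume : Measure unitInterval))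
    measurable_thresholdOfUniform.aemeasurable
  refine Measure.ext_of_Iic _ _ fun a => ?_
  rw [Measure.map_apply measurable_thresholdOfUniform measurableSet_Iic]
  have hpos (s : unitInterval) : 0 < (s : ℝ) * (Real.exp 1 - 1) + 1 := by
    have := mul_nonneg s.2.1 h0.le
    linarith
  have hiff (s : unitInterval) :
      s ∈ thresholdOfUniform ⁻¹' Iic a ↔ (s : ℝ) ≤ (Real.exp a - 1) / (Real.exp 1 - 1) := by
    rw [mem_preimage, mem_Iic, thresholdOfUniform, Real.log_le_iff_le_exp (hpos s),
      le_div_iff₀ h0, le_sub_iff_add_le]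
  rcases lt_or_ge a 0 with ha | ha
  · have h1 : thresholdOfUniform ⁻¹' Iic a = ∅ := by
      refine eq_empty_of_forall_notMem fun s hs => ?_
      have := (hiff s).1 hs
      have h2 : (Real.exp a - 1) / (Real.exp 1 - 1) < 0 :=
        div_neg_of_neg_of_pos (sub_neg.2 (Real.exp_zero ▸ Real.exp_lt_exp.2 ha)) h0
      linarith [s.2.1]
    rw [h1, measure_empty, thresholdLaw_Iic_of_neg ha]
  rcases le_or_gt a 1 with ha1 | ha1
  · have hmem : (Real.exp a - 1) / (Real.exp 1 - 1) ∈ unitInterval :=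
      ⟨div_nonneg (by linarith [Real.one_le_exp ha]) h0.le,
        (div_le_one h0).2 (by linarith [Real.exp_le_exp.2 ha1])⟩
    have h1 : thresholdOfUniform ⁻¹' Iic a = Iic ⟨_, hmem⟩ := by
      ext s
      rw [hiff s, mem_Iic, ← Subtype.coe_le_coe]
    rw [h1, unitInterval.volume_Iic, thresholdLaw_Iic ha ha1]
  · have h1 : thresholdOfUniform ⁻¹' Iic a = univ := by
      refine eq_univ_of_forall fun s => (hiff s).2 (s.2.2.trans ((one_le_div h0).2 ?_))
      linarith [Real.exp_le_exp.2 ha1.le]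
    have h2 : thresholdLaw (Iic a) = 1 := by
      refine le_antisymm prob_le_one ?_
      calc (1 : ENNReal) = thresholdLaw (Iic 1) := by
            rw [thresholdLaw_Iic zero_le_one le_rfl, div_self h0.ne', ENNReal.ofReal_one]
        _ ≤ thresholdLaw (Iic a) := measure_mono (Iic_subset_Iic.2 ha1.le)
    rw [h1, measure_univ, h2]

/-! ### Correctness and step count of the program -/

namespace Program

/-- The configuration at the beginning of the work on round `i`, with threshold `ρ`. -/
structure AtRound (ρ : ℝ) (x : ℕ → ℝ) (i : ℕ) (c : Config) : Prop where
  line : c.line = 7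
  halted : c.halted = false
  round : c.round = i
  value : c.reg 0 = x i
  threshold : c.reg 1 = ρ
  estimate : c.reg 2 = ∑ j ∈ Finset.range i, (x j)⁻¹
  one : c.reg 3 = 1
  zero : c.reg 5 = 0

variable {w : ℕ → unitInterval} {x : ℕ → ℝ} {n i : ℕ} {ρ : ℝ} {c : Config}

theorem atRound_zero (w : ℕ → unitInterval) (x : ℕ → ℝ) (n : ℕ) :
    AtRound (thresholdOfUniform (w 0)) x 0 (stoppingProgram.after w x n 7) := by
  constructor <;>
    simp [after, init, stoppingProgram, step, exec, write, thresholdOfUniform]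

/-- Zero needs its own test: division by zero returns 0 on the machine, whereas the estimator jumps
to `∞`. -/
theorem halts_of_eq_zero (h : AtRound ρ x i c) (hx : x i = 0) :
    (step stoppingProgram w x n)^[2] c =
      { c with line := 8, halted := true } := by
  obtain ⟨line, reg, used, round, halted⟩ := c
  obtain ⟨h1, h2, h3, h4, h5, h6, h7, h8⟩ := h
  dsimp only at h1 h2 h3 h4 h5 h6 h7 h8
  subst h1 h2 h3
  simp [stoppingProgram, step, exec, h4, h8, hx]

theorem halts_of_le (h : AtRound ρ x i c) (hx : 0 < x i)
    (hle : ρ ≤ ∑ j ∈ Finset.range (i + 1), (x j)⁻¹) :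
    ((step stoppingProgram w x n)^[5] c).halted = true ∧
      ((step stoppingProgram w x n)^[5] c).round = i := by
  obtain ⟨line, reg, used, round, halted⟩ := c
  obtain ⟨h1, h2, h3, h4, h5, h6, h7, h8⟩ := h
  dsimp only at h1 h2 h3 h4 h5 h6 h7 h8
  subst h1 h2 h3
  rw [Finset.sum_range_succ] at hle
  simp [stoppingProgram, step, exec, write, h4, h5, h6, h7, h8, hx, hle.not_gt]

theorem halts_of_horizon (h : AtRound ρ x n c) (hx : 0 < x n)
    (hlt : ∑ j ∈ Finset.range (n + 1), (x j)⁻¹ < ρ) :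
    ((step stoppingProgram w x n)^[5] c).halted = true ∧
      ((step stoppingProgram w x n)^[5] c).round = n := by
  obtain ⟨line, reg, used, round, halted⟩ := c
  obtain ⟨h1, h2, h3, h4, h5, h6, h7, h8⟩ := h
  dsimp only at h1 h2 h3 h4 h5 h6 h7 h8
  subst h1 h2 h3
  rw [Finset.sum_range_succ] at hlt
  simp [stoppingProgram, step, exec, write, h4, h5, h6, h7, h8, hx, hlt]

theorem atRound_succ (h : AtRound ρ x i c) (hi : i < n) (hx : 0 < x i)
    (hlt : ∑ j ∈ Finset.range (i + 1), (x j)⁻¹ < ρ) :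
    AtRound ρ x (i + 1) ((step stoppingProgram w x n)^[6] c) := by
  obtain ⟨line, reg, used, round, halted⟩ := c
  obtain ⟨h1, h2, h3, h4, h5, h6, h7, h8⟩ := h
  dsimp only at h1 h2 h3 h4 h5 h6 h7 h8
  subst h1 h2 h3
  have hlt' := hlt
  rw [Finset.sum_range_succ] at hlt'
  constructor <;>
    simp [stoppingProgram, step, exec, write, h4, h5, h6, h7, h8, hx, hlt', hi,
      Finset.sum_range_succ]

/-- From the beginning of round `i` on, the program stops in the right round. -/
theorem halts_of_atRound (hx : ∀ i, 0 ≤ x i) (m : ℕ) :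
    ∀ {i : ℕ} {c : Config}, i + m = n → AtRound ρ x i c →
      (∀ j < i, ¬ randomizedStopping.stops n j ρ x) →
      ∃ k, k + 6 * i ≤ 6 * (randomizedStopping.stopIndex n ρ x + 1) ∧
        ((step stoppingProgram w x n)^[k] c).halted = true ∧
        ((step stoppingProgram w x n)^[k] c).round = randomizedStopping.stopIndex n ρ x := by
  -- The term `6 * i` accounts for the rounds already passed, at six steps each; the stopping round
  -- takes at most five.
  induction m with
  | zero =>
    intro i c hi hc hns
    obtain rfl : i = n := hi
    rw [randomizedStopping.stopIndex_eq_of_stops le_rfl hns (Or.inl rfl)]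
    rcases (hx i).eq_or_lt with h0 | h0
    · exact ⟨2, by omega, by rw [halts_of_eq_zero hc h0.symm], by
        rw [halts_of_eq_zero hc h0.symm]; exact hc.round⟩
    rcases lt_or_ge (∑ j ∈ Finset.range (i + 1), (x j)⁻¹) ρ with h1 | h1
    · exact ⟨5, by omega, halts_of_horizon hc h0 h1⟩
    · exact ⟨5, by omega, halts_of_le hc h0 h1⟩
  | succ m ih =>
    intro i c hi hc hns
    by_cases hs : randomizedStopping.stops n i ρ x
    · rw [randomizedStopping.stopIndex_eq_of_stops (by omega) hns (Or.inr hs)]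
      rcases (hx i).eq_or_lt with h0 | h0
      · exact ⟨2, by omega, by rw [halts_of_eq_zero hc h0.symm], by
          rw [halts_of_eq_zero hc h0.symm]; exact hc.round⟩
      · have hpos : ∀ j ≤ i, 0 < x j := by
          intro j hj
          rcases hj.eq_or_lt with rfl | hj
          · exact h0
          · exact pos_of_not_stops hx (hns j hj)
        exact ⟨5, by omega, halts_of_le hc h0 ((stops_iff_of_pos hpos).1 hs)⟩
    · have hns' : ∀ j < i + 1, ¬ randomizedStopping.stops n j ρ x := by
        intro j hj
        rcases (Nat.lt_succ_iff.1 hj).eq_or_lt with rfl | hj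
        · exact hs
        · exact hns j hj
      have hpos : ∀ j ≤ i, 0 < x j := fun j hj =>
        pos_of_not_stops hx (hns' j (Nat.lt_succ_of_le hj))
      have hlt := not_le.1 (mt (stops_iff_of_pos (n := n) (ρ := ρ) hpos).2 hs)
      obtain ⟨k, hk, h1, h2⟩ := ih (by omega)
        (atRound_succ (w := w) hc (show i < n by omega) (hpos i le_rfl) hlt) hns'
      rw [← Function.iterate_add_apply] at h1 h2
      exact ⟨k + 6, by omega, h1, h2⟩

end Program

theorem isPolyTime_randomizedStopping : randomizedStopping.IsPolyTime := by
  refine ⟨stoppingProgram, fun w => thresholdOfUniform (w 0), 6 * Polynomial.X + 7, ?_, ?_⟩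
  · exact measurePreserving_thresholdOfUniform.comp
      (measurePreserving_eval_infinitePi (fun _ => (volume : Measure unitInterval)) 0)
  · intro w x n hx
    obtain ⟨k, hk, h1, h2⟩ := Program.halts_of_atRound (w := w) (n := n) hx n (zero_add n)
      (Program.atRound_zero w x n) (fun j hj => absurd hj (Nat.not_lt_zero j))
    rw [Program.after, ← Function.iterate_add_apply] at h1 h2
    refine ⟨k + 7, ?_, h1, h2⟩
    simp only [Polynomial.eval_add, Polynomial.eval_mul, Polynomial.eval_X,
      Polynomial.eval_ofNat]
    omega

end

theorem mainTheorem1 :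
    randomizedStopping.IsPolyTime ∧
    randomizedStopping.IsCompetitiveOn (Set.univ : Set StoppingInstance.{v})
      (Real.exp 1 / (Real.exp 1 - 1)) ∧
    ∀ ε : ℝ, 0 < ε → ∀ A : RandomizedAlgorithm.{u},
      ¬ A.IsCompetitiveOn StoppingInstance.skiRentalInstances.{v}
        (Real.exp 1 / (Real.exp 1 - 1) - ε) :=
  ⟨isPolyTime_randomizedStopping, isCompetitiveOn_randomizedStopping,
    fun _ hε A => A.not_isCompetitiveOn_skiRental (sub_lt_self _ hε)⟩
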